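/- Let $p$ be a prime number and $R$ a commutative ring in which $p$ is invertible. For finite groups $G,H$ let $RB(G,H)=R\otimes_{\mathbb Z}B(G,H)$, where $B(G,H)$ is the Grothendieck group of finite $(G,H)$-bisets under disjoint union, and let $R\mathcal C_p$ be the category whose objects are the finite $p$-groups, with $\mathrm{Hom}(G,H)=RB(H,G)$ and with composition induced by the product of bisets $V\times_H U=(V\times U)/H$. A $p$-biset functor over $R$ is an $R$-linear functor from $R\mathcal C_p$ to the category of $R$-modules; it is indecomposable if it is non-zero and is not isomorphic to a direct sum of two non-zero functors. For a finite group $G$ of order invertible in $R$, let $$\widetilde{e_G^G}=\frac1{|G|}\sum_{K\le G}|K|\,\mu(K,G)\,[G\times (G/K)]\in RB(G,G),$$ where $\mu$ is the Möbius function of the poset of subgroups of $G$ and $G\times (G/K)$ is the biset with $a\cdot(g,x)\cdot b=(agb,ax)$, and let $$\varphi_{\mathbf 1}^G=\sum_{M\trianglelefteq G,\ M\le\Phi(G)}\mu_{\trianglelefteq G}(\mathbf 1,M)\;\widetilde{e_G^G}\,[(G\times G)/\Delta_M(G)]\,\widetilde{e_G^G},\qquad \Delta_M(G)=\{(a,b)\in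 G\times G\mid ab^{-1}\in M\},$$ where $\Phi(G)$ is the Frattini subgroup and $\mu_{\trianglelefteq G}$ is the Möbius function of the poset of normal subgroups of $G$. A section of $G$ is a pair $(T,S)$ of subgroups of $G$ with $S\trianglelefteq T$; it is minimal if $S\le\Phi(T)$, and then one sets $$\epsilon_{T,S}^G=\frac{1}{|N_G(T,S):T|}\,\mathrm{Indinf}_{T/S}^G\,\varphi_{\mathbf 1}^{T/S}\,\mathrm{Defres}_{T/S}^G\in RB(G,G),$$ where $N_G(T,S)=N_G(T)\cap N_G(S)$, $\mathrm{Indinf}_{T/S}^G$ is the class of the $(G,T/S)$-biset $G/S$, and $\mathrm{Defres}_{T/S}^G$ is the class of the $(T/S,G)$-biset $S\backslash G$. A finite $p$-group is atoric if it has no decomposition $E\times Q$ with $E$ a non-trivial elementary abelian $p$-group. For a finite $p$-group $P$, let $P^@=P/N$, where $N$ is a maximal element of the set of normal subgroups of $P$ with $N\cap\Phi(P)=\mathbf 1$; up to isomorphism $P^@$ does not depend on $N$. For an atoric $p$-group $L$, let $b_L^P=\sum\epsilon_{T,S}^P$, where $(T,S)$ runs through representatives of the $P$-conjugacy classes of minimal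 sections of $P$ with $(T/S)^@\cong L$. For a $p$-biset functor $F$, let $(\widehat b_LF)(P)$ be the image of $F(b_L^P):F(P)\to F(P)$. A vertex of an indecomposable $p$-biset functor $F$ is an atoric $p$-group $L$ such that $F=\widehat b_LF$ (there is exactly one up to isomorphism). **Theorem.** Let $F$ be an indecomposable $p$-biset functor over $R$ and let $L$ be a vertex of $F$. If $Q$ is a finite $p$-group such that $F(Q)\neq\{0\}$ but $F(H)=\{0\}$ for every proper subquotient $H$ of $Q$ (that is, every $H\cong T/S$ with $(T,S)$ a section of $Q$ and $H\not\cong Q$), then $L\cong Q^@$. -/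

import Mathlib

open CategoryTheory MulOpposite
open scoped TensorProduct Pointwise

universe u v w

noncomputable section

namespace PBiset

/-! ### Finite bisets -/

/-- A finite `(G, H)`-biset: a finite set with a left action of `G` and a right action of `H`
(an action of `Hᵐᵒᵖ`, so that `u · h` is `op h • u`) which commute. -/
structure FinBiset (G H : Type u) [Group G] [Group H] : Type (u + 1) where
  carrier : Type u
  [leftAction : MulAction G carrier]
  [rightAction : MulAction Hᵐᵒᵖ carrier]
  [comm : SMulCommClass G Hᵐᵒᵖ carrier]
  [finite : Finite carrier]

attribute [instance] FinBiset.leftAction FinBiset.rightAction FinBiset.comm FinBiset.finite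

namespace FinBiset

variable {G H K J : Type u} [Group G] [Group H] [Group K] [Group J]

/-- Isomorphisms of bisets: equivariant bijections. -/
structure Iso (U V : FinBiset G H) extends U.carrier ≃ V.carrier where
  map_left : ∀ (g : G) (u : U.carrier), toFun (g • u) = g • toFun u
  map_right : ∀ (h : H) (u : U.carrier), toFun (op h • u) = op h • toFun u

/-- Two bisets are equivalent when they are isomorphic. -/
instance isoSetoid (G H : Type u) [Group G] [Group H] : Setoid (FinBiset G H) where
  r U V := Nonempty (Iso U V)
  iseqv :=
    { refl := fun U => ⟨⟨Equiv.refl _, fun _ _ => rfl, fun _ _ => rfl⟩⟩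
      symm := by
        rintro U V ⟨e⟩
        refine ⟨⟨e.toEquiv.symm, fun g u => ?_, fun h u => ?_⟩⟩
        · apply e.toEquiv.injective
          have := e.map_left g (e.toEquiv.symm u)
          simp_all
        · apply e.toEquiv.injective
          have := e.map_right h (e.toEquiv.symm u)
          simp_all
      trans := by
        rintro U V W ⟨e⟩ ⟨f⟩
        refine ⟨⟨e.toEquiv.trans f.toEquiv, fun g u => ?_, fun h u => ?_⟩⟩
        · exact (congrArg f.toFun (e.map_left g u)).trans (f.map_left _ _)
        · exact (congrArg f.toFun (e.map_right h u)).trans (f.map_right _ _) }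

/-- Disjoint union of bisets. -/
def sum (U V : FinBiset G H) : FinBiset G H where
  carrier := U.carrier ⊕ V.carrier

/-- The empty biset. -/
def empty (G H : Type u) [Group G] [Group H] : FinBiset G H :=
  letI leftAction : MulAction G (PEmpty) := { smul := fun _ x => x, one_smul := fun _ => rfl, mul_smul := fun _ _ _ => rfl }
  letI rightAction : MulAction Hᵐᵒᵖ (PEmpty) := { smul := fun _ x => x, one_smul := fun _ => rfl, mul_smul := fun _ _ _ => rfl }
  { carrier := PEmpty
    comm := ⟨fun _ _ x => x.elim⟩ }

/-- The `(G, G)`-biset `G`, with left and right multiplication. -/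
def identity (G : Type u) [Group G] [Finite G] : FinBiset G G where
  carrier := G

/-- The orbit relation of the right action `(u, v) · h = (u h, h⁻¹ v)` of `H` on `U × V`. -/
def prodSetoid (U : FinBiset K H) (V : FinBiset H G) : Setoid (U.carrier × V.carrier) where
  r x y := ∃ h : H, y = (op h • x.1, h⁻¹ • x.2)
  iseqv :=
    { refl := fun x => ⟨1, by simp⟩
      symm := by
        rintro x y ⟨h, rfl⟩
        exact ⟨h⁻¹, by simp⟩
      trans := by
        rintro x y z ⟨h, rfl⟩ ⟨k, rfl⟩
        exact ⟨h * k, by simp [mul_smul]⟩ }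

theorem prod_left_aux (U : FinBiset K H) (V : FinBiset H G) (k : K)
    (x y : U.carrier × V.carrier) (hxy : (prodSetoid U V) x y) :
    (prodSetoid U V) (k • x.1, x.2) (k • y.1, y.2) := by
  obtain ⟨h, rfl⟩ := hxy
  exact ⟨h, by simp [smul_comm]⟩

theorem prod_right_aux (U : FinBiset K H) (V : FinBiset H G) (g : Gᵐᵒᵖ)
    (x y : U.carrier × V.carrier) (hxy : (prodSetoid U V) x y) :
    (prodSetoid U V) (x.1, g • x.2) (y.1, g • y.2) := by
  obtain ⟨h, rfl⟩ := hxy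
  exact ⟨h, by simp [smul_comm]⟩

/-- The product `U ×_H V = (U × V) / H` of a `(K, H)`-biset and an `(H, G)`-biset. -/
def prod (U : FinBiset K H) (V : FinBiset H G) : FinBiset K G :=
  letI leftAction : MulAction K (Quotient (prodSetoid U V)) :=
    { smul := fun k => Quotient.map (fun x => (k • x.1, x.2)) (prod_left_aux U V k)
      one_smul := by rintro ⟨x⟩; exact congrArg (Quotient.mk _) (by simp)
      mul_smul := by
        rintro a b ⟨x⟩; exact congrArg (Quotient.mk _) (by simp [mul_smul]) }
  letI rightAction : MulAction Gᵐᵒᵖ (Quotient (prodSetoid U V)) :=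
    { smul := fun g => Quotient.map (fun x => (x.1, g • x.2)) (prod_right_aux U V g)
      one_smul := by rintro ⟨x⟩; exact congrArg (Quotient.mk _) (by simp)
      mul_smul := by
        rintro a b ⟨x⟩; exact congrArg (Quotient.mk _) (by simp [mul_smul]) }
  { carrier := Quotient (prodSetoid U V)
    comm := ⟨by rintro a b ⟨x⟩; rfl⟩ }

/-- The class of a pair in `U ×_H V`. -/
def prodMk (U : FinBiset K H) (V : FinBiset H G) (u : U.carrier) (v : V.carrier) :
    (prod U V).carrier :=
  Quotient.mk (prodSetoid U V) (u, v)

theorem prodMk_eq {U : FinBiset K H} {V : FinBiset H G} (h : H) (u : U.carrier) (v : V.carrier) :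
    prodMk U V (op h • u) v = prodMk U V u (h • v) := by
  refine (Quotient.sound ?_ : prodMk U V u (h • v) = prodMk U V (op h • u) v).symm
  exact ⟨h, by simp⟩

theorem prod_induction {U : FinBiset K H} {V : FinBiset H G} {C : (prod U V).carrier → Prop}
    (h : ∀ u v, C (prodMk U V u v)) (x : (prod U V).carrier) : C x := by
  obtain ⟨⟨u, v⟩⟩ := x
  exact h u v

/-- Maps out of `U ×_H V`. -/
def prodLift {U : FinBiset K H} {V : FinBiset H G} {X : Type u} (f : U.carrier → V.carrier → X)
    (hf : ∀ (h : H) u v, f (op h • u) v = f u (h • v)) : (prod U V).carrier → X :=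
  Quotient.lift (fun x => f x.1 x.2) (by
    rintro x y ⟨h, rfl⟩
    simp [hf])

/-- Isomorphic bisets have isomorphic products. -/
def prodCongr {U U' : FinBiset K H} {V V' : FinBiset H G} (e : Iso U U') (f : Iso V V') :
    Iso (prod U V) (prod U' V') where
  toFun := prodLift (fun u v => prodMk U' V' (e.toEquiv u) (f.toEquiv v)) (fun h u v => by
    have h1 := e.map_right h u
    have h2 := f.map_left h v
    simp only [Equiv.toFun_as_coe] at h1 h2
    rw [h1, h2, prodMk_eq])
  invFun := prodLift (fun u v => prodMk U V (e.toEquiv.symm u) (f.toEquiv.symm v)) (fun h u v => by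
    have h1 : e.toEquiv.symm (op h • u) = op h • e.toEquiv.symm u := by
      apply e.toEquiv.injective
      have := e.map_right h (e.toEquiv.symm u)
      simp_all
    have h2 : f.toEquiv.symm (h • v) = h • f.toEquiv.symm v := by
      apply f.toEquiv.injective
      have := f.map_left h (f.toEquiv.symm v)
      simp_all
    rw [h1, h2, prodMk_eq])
  left_inv := by
    refine prod_induction fun u v => ?_
    change prodMk U V _ _ = _
    simp
  right_inv := by
    refine prod_induction fun u v => ?_
    change prodMk U' V' _ _ = _
    simp
  map_left g := by
    refine prod_induction fun u v => ?_
    exact congrArg (fun z => prodMk U' V' z (f.toEquiv v)) (e.map_left g u)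
  map_right g := by
    refine prod_induction fun u v => ?_
    exact congrArg (fun z => prodMk U' V' (e.toEquiv u) z) (f.map_right g v)

/-- Associativity of the product of bisets. -/
def prodAssoc (U : FinBiset J K) (V : FinBiset K H) (W : FinBiset H G) :
    Iso (prod (prod U V) W) (prod U (prod V W)) where
  toFun := prodLift
    (fun x w => prodLift (fun u v => prodMk U (prod V W) u (prodMk V W v w))
      (fun k u v => prodMk_eq (V := prod V W) k u (prodMk V W v w)) x)
    (by
      intro h x w
      revert x
      refine prod_induction fun u v => ?_
      exact congrArg (prodMk U (prod V W) u) (prodMk_eq h v w))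
  invFun := prodLift
    (fun u y => prodLift (fun v w => prodMk (prod U V) W (prodMk U V u v) w)
      (fun h v w => prodMk_eq (U := prod U V) h (prodMk U V u v) w) y)
    (by
      intro k u y
      revert y
      refine prod_induction fun v w => ?_
      exact congrArg (fun z => prodMk (prod U V) W z w) (prodMk_eq k u v))
  left_inv := by
    refine prod_induction fun x w => ?_
    revert x
    exact prod_induction fun u v => rfl
  right_inv := by
    refine prod_induction fun u y => ?_
    revert y
    exact prod_induction fun v w => rfl
  map_left g := by
    refine prod_induction fun x w => ?_
    revert x
    exact prod_induction fun u v => rfl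
  map_right g := by
    refine prod_induction fun x w => ?_
    revert x
    exact prod_induction fun u v => rfl

/-- The identity biset is a left unit. -/
def identityProd [Finite H] (V : FinBiset H G) : Iso (prod (identity H) V) V where
  toFun := prodLift (fun (h : H) v => h • v) (fun h (k : H) v => by
    change (k * h) • v = k • h • v
    rw [mul_smul])
  invFun v := prodMk (identity H) V (1 : H) v
  left_inv := by
    refine prod_induction fun (h : H) v => ?_
    exact (prodMk_eq (U := identity H) h (1 : H) v).symm.trans
      (congrArg (fun z : H => prodMk (identity H) V z v) (one_mul h))
  right_inv v := one_smul H v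
  map_left g := by
    refine prod_induction fun (h : H) v => ?_
    exact mul_smul g h v
  map_right g := by
    refine prod_induction fun (h : H) v => ?_
    exact smul_comm h (op g) v

/-- The identity biset is a right unit. -/
def prodIdentity [Finite H] (U : FinBiset K H) : Iso (prod U (identity H)) U where
  toFun := prodLift (fun u (h : H) => op h • u) (fun h u (k : H) => by
    change op k • op h • u = op (h * k) • u
    rw [op_mul, mul_smul])
  invFun u := prodMk U (identity H) u (1 : H)
  left_inv := by
    refine prod_induction fun u (h : H) => ?_
    exact (prodMk_eq (V := identity H) h u (1 : H)).trans
      (congrArg (fun z : H => prodMk U (identity H) u z) (mul_one h))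
  right_inv u := one_smul Hᵐᵒᵖ u
  map_left g := by
    refine prod_induction fun u (h : H) => ?_
    exact (smul_comm g (op h) u).symm
  map_right g := by
    refine prod_induction fun u (h : H) => ?_
    change op (h * g) • u = op g • op h • u
    rw [op_mul, mul_smul]

/-- The product distributes over disjoint unions on the left. -/
def sumProd (U U' : FinBiset K H) (V : FinBiset H G) :
    Iso (prod (sum U U') V) (sum (prod U V) (prod U' V)) where
  toFun := prodLift (U := sum U U')
    (fun x v => Sum.elim (fun u => Sum.inl (prodMk U V u v)) (fun u => Sum.inr (prodMk U' V u v)) x)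
    (by
      rintro h (u | u) v
      · exact congrArg Sum.inl (prodMk_eq h u v)
      · exact congrArg Sum.inr (prodMk_eq h u v))
  invFun := Sum.elim
    (prodLift (fun u v => prodMk (sum U U') V (Sum.inl u) v)
      (fun h u v => prodMk_eq (U := sum U U') h (Sum.inl u) v))
    (prodLift (fun u v => prodMk (sum U U') V (Sum.inr u) v)
      (fun h u v => prodMk_eq (U := sum U U') h (Sum.inr u) v))
  left_inv := by
    refine prod_induction ?_
    rintro (u | u) v <;> rfl
  right_inv := by
    rintro (x | x) <;> revert x <;> exact prod_induction fun u v => rfl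
  map_left g := by
    refine prod_induction ?_
    rintro (u | u) v <;> rfl
  map_right g := by
    refine prod_induction ?_
    rintro (u | u) v <;> rfl

/-- The product distributes over disjoint unions on the right. -/
def prodSum (U : FinBiset K H) (V V' : FinBiset H G) :
    Iso (prod U (sum V V')) (sum (prod U V) (prod U V')) where
  toFun := prodLift (V := sum V V')
    (fun u x => Sum.elim (fun v => Sum.inl (prodMk U V u v)) (fun v => Sum.inr (prodMk U V' u v)) x)
    (by
      rintro h u (v | v)
      · exact congrArg Sum.inl (prodMk_eq h u v)
      · exact congrArg Sum.inr (prodMk_eq h u v))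
  invFun := Sum.elim
    (prodLift (fun u v => prodMk U (sum V V') u (Sum.inl v))
      (fun h u v => prodMk_eq (V := sum V V') h u (Sum.inl v)))
    (prodLift (fun u v => prodMk U (sum V V') u (Sum.inr v))
      (fun h u v => prodMk_eq (V := sum V V') h u (Sum.inr v)))
  left_inv := by
    refine prod_induction ?_
    rintro u (v | v) <;> rfl
  right_inv := by
    rintro (x | x) <;> revert x <;> exact prod_induction fun u v => rfl
  map_left g := by
    refine prod_induction ?_
    rintro u (v | v) <;> rfl
  map_right g := by
    refine prod_induction ?_
    rintro u (v | v) <;> rfl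

/-- The product with the empty biset is empty. -/
def emptyProd (V : FinBiset H G) : Iso (prod (empty K H) V) (empty K G) where
  toFun := prodLift (fun (x : PEmpty) _ => (x : PEmpty)) (fun _ x _ => x.elim)
  invFun x := PEmpty.elim x
  left_inv := prod_induction fun x _ => PEmpty.elim x
  right_inv x := PEmpty.elim x
  map_left _ := prod_induction fun x _ => PEmpty.elim x
  map_right _ := prod_induction fun x _ => PEmpty.elim x

/-- The product with the empty biset is empty. -/
def prodEmpty (U : FinBiset K H) : Iso (prod U (empty H G)) (empty K G) where
  toFun := prodLift (fun _ (x : PEmpty) => (x : PEmpty)) (fun _ _ x => x.elim)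
  invFun x := PEmpty.elim x
  left_inv := prod_induction fun _ x => PEmpty.elim x
  right_inv x := PEmpty.elim x
  map_left _ := prod_induction fun _ x => PEmpty.elim x
  map_right _ := prod_induction fun _ x => PEmpty.elim x

/-- The transitive `(G, H)`-biset `(G × H) / L`, with `a · (g, h)L · b = (a g, b⁻¹ h)L`. -/
def transitive [Finite G] [Finite H] (L : Subgroup (G × H)) : FinBiset G H :=
  letI leftAction : MulAction G ((G × H) ⧸ L) := MulAction.compHom _ (MonoidHom.inl G H)
  letI rightAction : MulAction Hᵐᵒᵖ ((G × H) ⧸ L) :=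
    { smul := fun b x => ((1 : G), (unop b)⁻¹) • x
      one_smul := fun x => by
        change ((1 : G), ((1 : H))⁻¹) • x = x
        rw [inv_one]
        exact one_smul (G × H) x
      mul_smul := fun a b x => by
        change ((1 : G), (unop b * unop a)⁻¹) • x =
          ((1 : G), (unop a)⁻¹) • (((1 : G), (unop b)⁻¹) • x)
        rw [smul_smul]
        simp }
  { carrier := (G × H) ⧸ L
    comm := ⟨fun a b x => by
      change (a, (1 : H)) • (((1 : G), (unop b)⁻¹) • x) = ((1 : G), (unop b)⁻¹) • ((a, (1 : H)) • x)
      rw [smul_smul, smul_smul]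
      simp⟩ }

/-- The `(G, G)`-biset `G × X` attached to a finite `G`-set `X`,
with `a · (g, x) · b = (a g b, a x)`. -/
def tilde (G : Type u) [Group G] [Finite G] (X : Type u) [MulAction G X] [Finite X] :
    FinBiset G G :=
  letI rightAction : MulAction Gᵐᵒᵖ (G × X) :=
    { smul := fun b y => (y.1 * unop b, y.2)
      one_smul := fun y => Prod.ext (mul_one _) rfl
      mul_smul := fun a b y => Prod.ext (mul_assoc _ _ _).symm rfl }
  { carrier := G × X
    comm := ⟨fun _ _ _ => Prod.ext (mul_assoc _ _ _).symm rfl⟩ }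

end FinBiset

/-! ### Burnside groups of bisets and the biset category -/

section Burnside

variable {G H K J : Type u} [Group G] [Group H] [Group K] [Group J]

/-- Isomorphism classes of finite `(G, H)`-bisets. -/
def BisetClass (G H : Type u) [Group G] [Group H] : Type (u + 1) :=
  Quotient (FinBiset.isoSetoid G H)

/-- The isomorphism class of a finite biset. -/
def BisetClass.mk (U : FinBiset G H) : BisetClass G H := Quotient.mk _ U

/-- The addition of isomorphism classes of bisets is the disjoint union. -/
instance : Add (BisetClass G H) where
  add := Quotient.map₂ FinBiset.sum (by
    rintro U U' ⟨e⟩ V V' ⟨f⟩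
    refine ⟨⟨Equiv.sumCongr e.toEquiv f.toEquiv, ?_, ?_⟩⟩
    · rintro g (u | u)
      · exact congrArg Sum.inl (e.map_left g u)
      · exact congrArg Sum.inr (f.map_left g u)
    · rintro g (u | u)
      · exact congrArg Sum.inl (e.map_right g u)
      · exact congrArg Sum.inr (f.map_right g u))

instance : Zero (BisetClass G H) where
  zero := BisetClass.mk (FinBiset.empty G H)

/-- Isomorphism classes of finite bisets form a commutative monoid under disjoint union. -/
instance : AddCommMonoid (BisetClass G H) where
  add_assoc := by
    rintro ⟨U⟩ ⟨V⟩ ⟨W⟩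
    refine Quotient.sound ⟨⟨Equiv.sumAssoc _ _ _, ?_, ?_⟩⟩
    · rintro g ((u | u) | u) <;> rfl
    · rintro g ((u | u) | u) <;> rfl
  zero_add := by
    rintro ⟨U⟩
    refine Quotient.sound ⟨⟨Equiv.emptySum PEmpty U.carrier, ?_, ?_⟩⟩
    · rintro g (u | u)
      · exact PEmpty.elim u
      · rfl
    · rintro g (u | u)
      · exact PEmpty.elim u
      · rfl
  add_zero := by
    rintro ⟨U⟩
    refine Quotient.sound ⟨⟨Equiv.sumEmpty U.carrier PEmpty, ?_, ?_⟩⟩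
    · rintro g (u | u)
      · rfl
      · exact PEmpty.elim u
    · rintro g (u | u)
      · rfl
      · exact PEmpty.elim u
  add_comm := by
    rintro ⟨U⟩ ⟨V⟩
    refine Quotient.sound ⟨⟨Equiv.sumComm _ _, ?_, ?_⟩⟩
    · rintro g (u | u) <;> rfl
    · rintro g (u | u) <;> rfl
  nsmul := nsmulRec

/-- The product `×_H` on isomorphism classes. -/
def BisetClass.prod (a : BisetClass K H) (b : BisetClass H G) : BisetClass K G :=
  Quotient.map₂ FinBiset.prod
    (by rintro U U' ⟨e⟩ V V' ⟨f⟩; exact ⟨FinBiset.prodCongr e f⟩) a b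

/-- The Burnside group `B(G, H)`: the Grothendieck group of finite `(G, H)`-bisets. -/
def Burnside (G H : Type u) [Group G] [Group H] : Type (u + 1) :=
  Algebra.GrothendieckAddGroup (BisetClass G H)

instance : AddCommGroup (Burnside G H) :=
  inferInstanceAs (AddCommGroup (Algebra.GrothendieckAddGroup (BisetClass G H)))

/-- The canonical map from isomorphism classes to the Grothendieck group. -/
def Burnside.of : BisetClass G H →+ Burnside G H := Algebra.GrothendieckAddGroup.of

/-- The universal property of the Grothendieck group. -/
def Burnside.lift {A : Type w} [AddCommGroup A] (f : BisetClass G H →+ A) : Burnside G H →+ A :=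
  Algebra.GrothendieckAddGroup.lift f

theorem Burnside.lift_of {A : Type w} [AddCommGroup A] (f : BisetClass G H →+ A)
    (m : BisetClass G H) : Burnside.lift f (Burnside.of m) = f m :=
  DFunLike.congr_fun (Algebra.GrothendieckAddGroup.lift.symm_apply_apply f) m

theorem Burnside.hom_ext {A : Type w} [AddCommGroup A] {f g : Burnside G H →+ A}
    (h : ∀ m, f (Burnside.of m) = g (Burnside.of m)) : f = g :=
  Algebra.GrothendieckAddGroup.lift.symm.injective (AddMonoidHom.ext h)

/-- The product `×_H` on isomorphism classes, as a biadditive map. -/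
def BisetClass.prodHom : BisetClass K H →+ BisetClass H G →+ BisetClass K G where
  toFun a :=
    { toFun := fun b => BisetClass.prod a b
      map_zero' := by
        obtain ⟨U⟩ := a
        exact Quotient.sound ⟨FinBiset.prodEmpty U⟩
      map_add' := by
        obtain ⟨U⟩ := a
        rintro ⟨V⟩ ⟨V'⟩
        exact Quotient.sound ⟨FinBiset.prodSum U V V'⟩ }
  map_zero' := by
    ext b
    obtain ⟨V⟩ := b
    exact Quotient.sound ⟨FinBiset.emptyProd V⟩
  map_add' := by
    rintro ⟨U⟩ ⟨U'⟩
    ext b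
    obtain ⟨V⟩ := b
    exact Quotient.sound ⟨FinBiset.sumProd U U' V⟩

/-- The biadditive product `×_H : B(K, H) × B(H, G) → B(K, G)` induced by the product of
bisets. -/
def Burnside.prod : Burnside K H →+ Burnside H G →+ Burnside K G :=
  Burnside.lift
    { toFun := fun a => Burnside.lift (Burnside.of.comp (BisetClass.prodHom a))
      map_zero' := by
        refine Burnside.hom_ext fun m => ?_
        rw [Burnside.lift_of]
        simp
      map_add' := fun a b => by
        refine Burnside.hom_ext fun m => ?_
        rw [AddMonoidHom.add_apply, Burnside.lift_of, Burnside.lift_of, Burnside.lift_of]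
        simp }

theorem Burnside.prod_of (a : BisetClass K H) (b : BisetClass H G) :
    Burnside.prod (Burnside.of a) (Burnside.of b) = Burnside.of (BisetClass.prod a b) := by
  rw [Burnside.prod, Burnside.lift_of]
  exact Burnside.lift_of _ b

theorem Burnside.induction {C : Burnside G H → Prop} (h_of : ∀ m, C (Burnside.of m))
    (h_sub : ∀ x y, C x → C y → C (x - y)) (x : Burnside G H) : C x := by
  let S : AddSubgroup (Burnside G H) := AddSubgroup.closure (Set.range Burnside.of)
  have hS : QuotientAddGroup.mk' S = 0 := by
    refine Burnside.hom_ext fun m => ?_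
    exact (QuotientAddGroup.eq_zero_iff _).2 (AddSubgroup.subset_closure ⟨m, rfl⟩)
  have hx : x ∈ S := (QuotientAddGroup.eq_zero_iff x).1 (DFunLike.congr_fun hS x)
  have h0 : C 0 := by
    have := h_of 0
    rwa [map_zero] at this
  have hneg : ∀ y, C y → C (-y) := fun y hy => by
    have := h_sub 0 y h0 hy
    rwa [zero_sub] at this
  induction hx using AddSubgroup.closure_induction with
  | mem x hx => obtain ⟨m, rfl⟩ := hx; exact h_of m
  | zero => exact h0
  | add x y _ _ hx hy =>
    have := h_sub x (-y) hx (hneg y hy)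
    rwa [sub_neg_eq_add] at this
  | neg x _ hx => exact hneg x hx

theorem Burnside.sub_prod (x y : Burnside K H) (b : Burnside H G) :
    Burnside.prod (x - y) b = Burnside.prod x b - Burnside.prod y b := by
  rw [map_sub, AddMonoidHom.sub_apply]

theorem Burnside.prod_assoc (a : Burnside J K) (b : Burnside K H) (c : Burnside H G) :
    Burnside.prod (Burnside.prod a b) c = Burnside.prod a (Burnside.prod b c) := by
  induction a using Burnside.induction with
  | h_sub x y hx hy => simp only [Burnside.sub_prod, hx, hy]
  | h_of a =>
    induction b using Burnside.induction with
    | h_sub x y hx hy => rw [map_sub, Burnside.sub_prod, Burnside.sub_prod, map_sub, hx, hy]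
    | h_of b =>
      induction c using Burnside.induction with
      | h_sub x y hx hy => simp only [map_sub, hx, hy]
      | h_of c =>
        simp only [Burnside.prod_of]
        obtain ⟨U⟩ := a
        obtain ⟨V⟩ := b
        obtain ⟨W⟩ := c
        exact congrArg Burnside.of (Quotient.sound ⟨FinBiset.prodAssoc U V W⟩)

/-- The class of the `(G, G)`-biset `G`. -/
def Burnside.one (G : Type u) [Group G] [Finite G] : Burnside G G :=
  Burnside.of (BisetClass.mk (FinBiset.identity G))

theorem Burnside.one_prod [Finite H] (b : Burnside H G) :
    Burnside.prod (Burnside.one H) b = b := by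
  induction b using Burnside.induction with
  | h_sub x y hx hy => rw [map_sub, hx, hy]
  | h_of b =>
    rw [Burnside.one, Burnside.prod_of]
    obtain ⟨V⟩ := b
    exact congrArg Burnside.of (Quotient.sound ⟨FinBiset.identityProd V⟩)

theorem Burnside.prod_one [Finite H] (a : Burnside K H) :
    Burnside.prod a (Burnside.one H) = a := by
  induction a using Burnside.induction with
  | h_sub x y hx hy => rw [Burnside.sub_prod, hx, hy]
  | h_of a =>
    rw [Burnside.one, Burnside.prod_of]
    obtain ⟨V⟩ := a
    exact congrArg Burnside.of (Quotient.sound ⟨FinBiset.prodIdentity V⟩)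

variable (R : Type v) [CommRing R]

/-- `R B(G, H) = R ⊗_ℤ B(G, H)`. -/
abbrev RB (G H : Type u) [Group G] [Group H] : Type (max v (u + 1)) :=
  R ⊗[ℤ] Burnside G H

variable {R}

/-- The biadditive extension of the product `×_H` to coefficients in `R`:
`(r ⊗ a) ×_H (s ⊗ b) = r s ⊗ (a ×_H b)`. -/
def RB.prodHom : RB R K H →ₗ[ℤ] RB R H G →ₗ[ℤ] RB R K G :=
  TensorProduct.map₂ (LinearMap.mul ℤ R)
    (AddMonoidHom.toIntLinearMap
      ({ toFun := fun a => (Burnside.prod a).toIntLinearMap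
         map_zero' := by ext; simp
         map_add' := fun x y => by ext; simp } : Burnside K H →+ Burnside H G →ₗ[ℤ] Burnside K G))

/-- The composition product `×_H : R B(K, H) × R B(H, G) → R B(K, G)`. -/
def RB.prod (a : RB R K H) (b : RB R H G) : RB R K G := RB.prodHom a b

theorem RB.prod_tmul (r s : R) (a : Burnside K H) (b : Burnside H G) :
    RB.prod (r ⊗ₜ[ℤ] a) (s ⊗ₜ[ℤ] b) = (r * s) ⊗ₜ[ℤ] Burnside.prod a b := rfl

theorem RB.add_prod (a a' : RB R K H) (b : RB R H G) :
    RB.prod (a + a') b = RB.prod a b + RB.prod a' b := by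
  simp [RB.prod]

theorem RB.prod_add (a : RB R K H) (b b' : RB R H G) :
    RB.prod a (b + b') = RB.prod a b + RB.prod a b' := by
  simp [RB.prod]

theorem RB.zero_prod (b : RB R H G) : RB.prod (0 : RB R K H) b = 0 := by
  simp [RB.prod]

theorem RB.prod_zero (a : RB R K H) : RB.prod a (0 : RB R H G) = 0 := by
  simp [RB.prod]

theorem RB.smul_prod (r : R) (a : RB R K H) (b : RB R H G) :
    RB.prod (r • a) b = r • RB.prod a b := by
  induction a using TensorProduct.induction_on with
  | zero => simp [RB.zero_prod]
  | add x y hx hy => rw [smul_add, RB.add_prod, RB.add_prod, smul_add, hx, hy]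
  | tmul s a =>
    induction b using TensorProduct.induction_on with
    | zero => simp [RB.prod_zero]
    | add x y hx hy => rw [RB.prod_add, RB.prod_add, smul_add, hx, hy]
    | tmul t b =>
      rw [TensorProduct.smul_tmul', RB.prod_tmul, RB.prod_tmul, TensorProduct.smul_tmul',
        smul_eq_mul, smul_eq_mul, mul_assoc]

theorem RB.prod_smul (r : R) (a : RB R K H) (b : RB R H G) :
    RB.prod a (r • b) = r • RB.prod a b := by
  induction a using TensorProduct.induction_on with
  | zero => simp [RB.zero_prod]
  | add x y hx hy => rw [RB.add_prod, RB.add_prod, smul_add, hx, hy]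
  | tmul s a =>
    induction b using TensorProduct.induction_on with
    | zero => simp [RB.prod_zero]
    | add x y hx hy => rw [smul_add, RB.prod_add, RB.prod_add, smul_add, hx, hy]
    | tmul t b =>
      rw [TensorProduct.smul_tmul', RB.prod_tmul, RB.prod_tmul, TensorProduct.smul_tmul',
        smul_eq_mul, smul_eq_mul, mul_left_comm]

theorem RB.prod_assoc (a : RB R J K) (b : RB R K H) (c : RB R H G) :
    RB.prod (RB.prod a b) c = RB.prod a (RB.prod b c) := by
  induction a using TensorProduct.induction_on with
  | zero => simp [RB.zero_prod]
  | add x y hx hy => simp only [RB.add_prod, hx, hy]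
  | tmul r a =>
    induction b using TensorProduct.induction_on with
    | zero => simp [RB.zero_prod, RB.prod_zero]
    | add x y hx hy => simp only [RB.add_prod, RB.prod_add, hx, hy]
    | tmul s b =>
      induction c using TensorProduct.induction_on with
      | zero => simp [RB.prod_zero]
      | add x y hx hy => simp only [RB.prod_add, hx, hy]
      | tmul t c => simp only [RB.prod_tmul, Burnside.prod_assoc, mul_assoc]

/-- The identity element of `R B(G, G)`. -/
def RB.one (R : Type v) [CommRing R] (G : Type u) [Group G] [Finite G] : RB R G G :=
  (1 : R) ⊗ₜ[ℤ] Burnside.one G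

theorem RB.one_prod [Finite H] (b : RB R H G) : RB.prod (RB.one R H) b = b := by
  induction b using TensorProduct.induction_on with
  | zero => simp [RB.prod_zero]
  | add x y hx hy => rw [RB.prod_add, hx, hy]
  | tmul t b => rw [RB.one, RB.prod_tmul, Burnside.one_prod, one_mul]

theorem RB.prod_one [Finite H] (a : RB R K H) : RB.prod a (RB.one R H) = a := by
  induction a using TensorProduct.induction_on with
  | zero => simp [RB.zero_prod]
  | add x y hx hy => rw [RB.add_prod, hx, hy]
  | tmul t b => rw [RB.one, RB.prod_tmul, Burnside.prod_one, mul_one]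

/-- The class `[U]` of a finite biset in `R B(G, H)`. -/
def RB.mk (R : Type v) [CommRing R] (U : FinBiset G H) : RB R G H :=
  (1 : R) ⊗ₜ[ℤ] Burnside.of (BisetClass.mk U)

end Burnside

section Category

/-- The objects of the biset category `RC`: the finite groups. -/
structure BisetCat (R : Type v) : Type (u + 1) where
  carrier : Type u
  [group : Group carrier]
  [finite : Finite carrier]

attribute [instance] BisetCat.group BisetCat.finite

variable {R : Type v} [CommRing R]

/-- The biset category `RC`: morphisms from `G` to `H` are the elements of `R B(H, G)`, and the
composition of `f ∈ R B(H, G)` followed by `g ∈ R B(K, H)` is `g ×_H f`. -/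
instance : Category.{max v (u + 1)} (BisetCat.{u, v} R) where
  Hom G H := RB R H.carrier G.carrier
  id G := RB.one R G.carrier
  comp f g := RB.prod g f
  id_comp f := RB.prod_one f
  comp_id f := RB.one_prod f
  assoc f g h := (RB.prod_assoc h g f).symm

instance : Preadditive (BisetCat.{u, v} R) where
  homGroup G H := inferInstanceAs (AddCommGroup (RB R H.carrier G.carrier))
  add_comp _ _ _ f f' g := RB.prod_add g f f'
  comp_add _ _ _ f g g' := RB.add_prod g g' f

instance : Linear R (BisetCat.{u, v} R) where
  homModule G H := inferInstanceAs (Module R (RB R H.carrier G.carrier))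
  smul_comp _ _ _ r f g := RB.prod_smul r g f
  comp_smul _ _ _ f r g := RB.smul_prod r g f

variable (R)

/-- The full subcategory `RC_p` of the biset category consisting of the finite `p`-groups. -/
abbrev PBisetCat (p : ℕ) : Type (u + 1) :=
  ObjectProperty.FullSubcategory (fun G : BisetCat.{u, v} R => IsPGroup p G.carrier)

/-- A finite `p`-group as an object of `RC_p`. -/
def PBisetCat.of {p : ℕ} (P : Type u) [Group P] [Finite P] (hP : IsPGroup p P) :
    PBisetCat.{u, v} R p :=
  ⟨⟨P⟩, hP⟩

end Category

/-! ### Sections, the Frattini subgroup and atoric `p`-groups -/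

section Groups

/-- A section `(T, S)` of `G`: subgroups `S ⊴ T ≤ G`. -/
@[ext]
structure GroupSection (G : Type u) [Group G] where
  T : Subgroup G
  S : Subgroup G
  le : S ≤ T
  normal : (S.subgroupOf T).Normal

namespace GroupSection

variable {G : Type u} [Group G]

instance (s : GroupSection G) : (s.S.subgroupOf s.T).Normal := s.normal

/-- The quotient group `T / S`. -/
abbrev Quot (s : GroupSection G) : Type u := s.T ⧸ s.S.subgroupOf s.T

/-- A section is minimal if `S ≤ Φ(T)`. -/
def IsMinimal (s : GroupSection G) : Prop := s.S.subgroupOf s.T ≤ frattini s.T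

/-- Conjugate sections: `(T', S') = (ᵍT, ᵍS)` for some `g`. -/
def conjSetoid (G : Type u) [Group G] : Setoid {s : GroupSection G // s.IsMinimal} where
  r s t := ∃ g : G, t.1.T = MulAut.conj g • s.1.T ∧ t.1.S = MulAut.conj g • s.1.S
  iseqv :=
    { refl := fun s => ⟨1, by simp⟩
      symm := by
        rintro s t ⟨g, h1, h2⟩
        exact ⟨g⁻¹, by simp [h1], by simp [h2]⟩
      trans := by
        rintro s t r ⟨g, h1, h2⟩ ⟨k, h3, h4⟩
        exact ⟨k * g, by simp [h1, h3, mul_smul], by simp [h2, h4, mul_smul]⟩ }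

/-- `N_G(T, S) = N_G(T) ∩ N_G(S)`. -/
def normalizer (s : GroupSection G) : Subgroup G :=
  Subgroup.normalizer (s.T : Set G) ⊓ Subgroup.normalizer (s.S : Set G)

/-- `Indinf_{T/S}^G`: the `(G, T/S)`-biset `G/S`, with `a · gS · tS = a g t S`. -/
def indinf [Finite G] (s : GroupSection G) : FinBiset G s.Quot :=
  letI rightAction : MulAction s.Quotᵐᵒᵖ (G ⧸ s.S) :=
    { smul := fun t x => Quotient.map₂ (fun (t : s.T) (g : G) => g * (t : G))
        (by
          intro t t' htt g g' hgg
          have h1 : t⁻¹ * t' ∈ s.S.subgroupOf s.T := QuotientGroup.leftRel_apply.1 htt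
          have h2 : g⁻¹ * g' ∈ s.S := QuotientGroup.leftRel_apply.1 hgg
          refine QuotientGroup.leftRel_apply.2 ?_
          have h3 : g⁻¹ * g' ∈ s.T := s.le h2
          have h4 : t⁻¹ * ⟨g⁻¹ * g', h3⟩ * t⁻¹⁻¹ ∈ s.S.subgroupOf s.T :=
            s.normal.conj_mem ⟨g⁻¹ * g', h3⟩ h2 t⁻¹
          have h5 := s.S.mul_mem (Subgroup.mem_subgroupOf.1 h4) (Subgroup.mem_subgroupOf.1 h1)
          simpa [mul_assoc] using h5) (unop t) x
      one_smul := by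
        rintro ⟨g⟩
        exact congrArg (QuotientGroup.mk (s := s.S)) (mul_one g)
      mul_smul := by
        rintro ⟨⟨a⟩⟩ ⟨⟨b⟩⟩ ⟨g⟩
        exact congrArg (QuotientGroup.mk (s := s.S)) (mul_assoc g (b : G) (a : G)).symm }
  { carrier := G ⧸ s.S
    comm := ⟨by
      rintro a ⟨⟨b⟩⟩ ⟨g⟩
      exact congrArg (QuotientGroup.mk (s := s.S)) (mul_assoc a g (b : G)).symm⟩ }

/-- `Defres_{T/S}^G`: the `(T/S, G)`-biset `S\G`, with `tS · Sg · a = S t g a`. -/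
def defres [Finite G] (s : GroupSection G) : FinBiset s.Quot G :=
  letI leftAction : MulAction s.Quot (Quotient (QuotientGroup.rightRel s.S)) :=
    { smul := fun t x => Quotient.map₂ (fun (t : s.T) (g : G) => (t : G) * g)
        (by
          intro t t' htt g g' hgg
          have h1 : t⁻¹ * t' ∈ s.S.subgroupOf s.T := QuotientGroup.leftRel_apply.1 htt
          have h2 : g' * g⁻¹ ∈ s.S := QuotientGroup.rightRel_apply.1 hgg
          refine QuotientGroup.rightRel_apply.2 ?_
          have h3 : g' * g⁻¹ ∈ s.T := s.le h2
          have h4 : t' * ⟨g' * g⁻¹, h3⟩ * t'⁻¹ ∈ s.S.subgroupOf s.T :=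
            s.normal.conj_mem ⟨g' * g⁻¹, h3⟩ h2 t'
          have h5 : t * (t⁻¹ * t') * t⁻¹ ∈ s.S.subgroupOf s.T := s.normal.conj_mem _ h1 t
          have h6 := s.S.mul_mem (Subgroup.mem_subgroupOf.1 h4) (Subgroup.mem_subgroupOf.1 h5)
          simpa [mul_assoc] using h6) t x
      one_smul := by
        rintro ⟨g⟩
        exact congrArg (Quotient.mk (QuotientGroup.rightRel s.S)) (one_mul g)
      mul_smul := by
        rintro ⟨a⟩ ⟨b⟩ ⟨g⟩
        exact congrArg (Quotient.mk (QuotientGroup.rightRel s.S)) (mul_assoc (a : G) (b : G) g) }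
  letI rightAction : MulAction Gᵐᵒᵖ (Quotient (QuotientGroup.rightRel s.S)) :=
    { smul := fun a => Quotient.map (fun g : G => g * unop a)
        (by
          intro g g' hgg
          have h2 : g' * g⁻¹ ∈ s.S := QuotientGroup.rightRel_apply.1 hgg
          refine QuotientGroup.rightRel_apply.2 ?_
          simpa [mul_assoc] using h2)
      one_smul := by
        rintro ⟨g⟩
        exact congrArg (Quotient.mk (QuotientGroup.rightRel s.S)) (mul_one g)
      mul_smul := by
        rintro a b ⟨g⟩
        exact congrArg (Quotient.mk (QuotientGroup.rightRel s.S))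
          (mul_assoc g (unop b) (unop a)).symm }
  { carrier := Quotient (QuotientGroup.rightRel s.S)
    comm := ⟨by
      rintro ⟨a⟩ b ⟨g⟩
      exact congrArg (Quotient.mk (QuotientGroup.rightRel s.S)) (mul_assoc (a : G) g (unop b)).symm⟩
    finite := Quotient.finite _ }

end GroupSection

/-- `H` is a subquotient of `G`: there is a section `(T, S)` of `G` with `T/S ≅ H`. -/
def IsSubquotient (H G : Type u) [Group H] [Group G] : Prop :=
  ∃ s : GroupSection G, Nonempty (s.Quot ≃* H)

/-- `H` is a proper subquotient of the finite group `G`: a subquotient not isomorphic to `G`. -/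
def IsProperSubquotient (H G : Type u) [Group H] [Group G] : Prop :=
  IsSubquotient H G ∧ ¬ Nonempty (H ≃* G)

/-- Elementary abelian `p`-groups. -/
def IsElementaryAbelian (p : ℕ) (E : Type u) [Group E] : Prop :=
  (∀ x y : E, x * y = y * x) ∧ ∀ x : E, x ^ p = 1

/-- A finite `p`-group is atoric if it has no decomposition `P = E × Q` with `E` a non-trivial
elementary abelian `p`-group. -/
def IsAtoric (p : ℕ) (P : Type u) [Group P] : Prop :=
  Finite P ∧ IsPGroup p P ∧ ∀ (E Q : Type u) [Group E] [Group Q],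
    Nonempty (P ≃* E × Q) → IsElementaryAbelian p E → Subsingleton E

/-- The normal subgroups `N` of `P` with `N ∩ Φ(P) = 1`. -/
def frattiniFree (P : Type u) [Group P] : Set (Subgroup P) :=
  {N | N.Normal ∧ N ⊓ frattini P = ⊥}

theorem exists_maximal_frattiniFree (P : Type u) [Group P] [Finite P] :
    ∃ N : Subgroup P, Maximal (· ∈ frattiniFree P) N :=
  (Set.toFinite (frattiniFree P)).exists_maximal ⟨⊥, inferInstance, bot_inf_eq _⟩

/-- A chosen maximal normal subgroup `N` of `P` such that `N ∩ Φ(P) = 1`. -/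
def atoricKernel (P : Type u) [Group P] [Finite P] : Subgroup P :=
  (exists_maximal_frattiniFree P).choose

theorem atoricKernel_maximal (P : Type u) [Group P] [Finite P] :
    Maximal (· ∈ frattiniFree P) (atoricKernel P) :=
  (exists_maximal_frattiniFree P).choose_spec

instance (P : Type u) [Group P] [Finite P] : (atoricKernel P).Normal :=
  (atoricKernel_maximal P).1.1

/-- The group `P^@ = P / N`, for a maximal normal subgroup `N` of `P` with `N ∩ Φ(P) = 1`. -/
abbrev AtoricQuotient (P : Type u) [Group P] [Finite P] : Type u := P ⧸ atoricKernel P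

end Groups

/-! ### The idempotents -/

section Idempotents

open Classical in
/-- The Möbius function of a finite poset. -/
def moebius {α : Type u} [PartialOrder α] [Finite α] (a b : α) : ℤ :=
  letI : Fintype α := Fintype.ofFinite α
  letI : LocallyFiniteOrder α := Fintype.toLocallyFiniteOrder
  IncidenceAlgebra.mu ℤ a b

/-- The poset of normal subgroups of `G`. -/
abbrev NormalSubgroup (G : Type u) [Group G] : Type u := {N : Subgroup G // N.Normal}

/-- The trivial normal subgroup. -/
def NormalSubgroup.trivial (G : Type u) [Group G] : NormalSubgroup G := ⟨⊥, inferInstance⟩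

/-- The subgroup `Δ_N(G) = {(a, b) | a b⁻¹ ∈ N}` of `G × G`. -/
def diagonalMod {G : Type u} [Group G] (N : NormalSubgroup G) : Subgroup (G × G) where
  carrier := {x | x.1 * x.2⁻¹ ∈ N.1}
  one_mem' := by simp
  mul_mem' {x y} hx hy := by
    have h := N.1.mul_mem (N.2.conj_mem _ hy x.1) hx
    change (x * y).1 * (x * y).2⁻¹ ∈ N.1
    simpa [mul_assoc] using h
  inv_mem' {x} hx := by
    have h := N.2.conj_mem _ (N.1.inv_mem hx) x.1⁻¹
    change (x⁻¹).1 * (x⁻¹).2⁻¹ ∈ N.1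
    simpa [mul_assoc] using h

variable (R : Type v) [CommRing R] (G : Type u) [Group G] [Finite G]

/-- The image in `R B(G, G)` under `X ↦ G × X` of the top idempotent
`e_G^G = |G|⁻¹ ∑_{K ≤ G} |K| μ(K, G) [G/K]` of the Burnside algebra of `G`. (Inverses in `R` are
taken with `Ring.inverse`, for elements which are units whenever `|G|` is a unit of `R`.) -/
def topIdempotent : RB R G G :=
  Ring.inverse (Nat.card G : R) •
    ∑ᶠ K : Subgroup G, ((Nat.card K : R) * (moebius K ⊤ : R)) • RB.mk R (FinBiset.tilde G (G ⧸ K))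

variable {G}

/-- `Y_L = ẽ [(G × G)/L] ẽ`, where `ẽ` is the previous idempotent. -/
def cutTransitive (L : Subgroup (G × G)) : RB R G G :=
  RB.prod (RB.prod (topIdempotent R G) (RB.mk R (FinBiset.transitive L))) (topIdempotent R G)

variable (G)

/-- `φ_1^G = ∑ μ_{⊴G}(1, M) Y_{Δ_M(G)}`, over the normal subgroups `M` of `G` contained
in `Φ(G)`. -/
def phiOne : RB R G G :=
  ∑ᶠ (M : NormalSubgroup G) (_ : M.1 ≤ frattini G),
    (moebius (NormalSubgroup.trivial G) M : R) • cutTransitive R (diagonalMod M)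

variable {G}

/-- `ε_{T,S}^G = |N_G(T, S) : T|⁻¹ Indinf_{T/S}^G φ_1^{T/S} Defres_{T/S}^G`. -/
def epsilon (s : GroupSection G) : RB R G G :=
  Ring.inverse ((s.T.relIndex s.normalizer : ℕ) : R) •
    RB.prod (RB.prod (RB.mk R s.indinf) (phiOne R s.Quot)) (RB.mk R s.defres)

/-- `b_L^P = ∑ ε_{T,S}^P`, over representatives `(T, S)` of the conjugacy classes of minimal
sections of `P` such that `(T/S)^@ ≅ L`. -/
def bIdempotent (L P : Type u) [Group L] [Group P] [Finite P] : RB R P P :=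
  ∑ᶠ (c : Quotient (GroupSection.conjSetoid P))
    (_ : Nonempty (AtoricQuotient c.out.1.Quot ≃* L)), epsilon R c.out.1

end Idempotents

/-! ### Vertices -/

section Vertex

variable {R : Type v} [CommRing R] {p : ℕ}

/-- The evaluation at `P` of `b̂_L F`, the image of the endomorphism `F(b_L)` of `F`. -/
def bImage (L : Type u) [Group L] (F : PBisetCat.{u, v} R p ⥤ ModuleCat.{w} R)
    (P : PBisetCat.{u, v} R p) : Submodule R (F.obj P) :=
  LinearMap.range
    (F.map (ObjectProperty.homMk (bIdempotent R L P.obj.carrier : P.obj ⟶ P.obj) : P ⟶ P)).hom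

/-- `L` is a vertex of `F`: an atoric `p`-group such that `b̂_L F = F`. -/
def IsVertex (L : Type u) [Group L] (F : PBisetCat.{u, v} R p ⥤ ModuleCat.{w} R) : Prop :=
  IsAtoric p L ∧ ∀ P : PBisetCat.{u, v} R p, bImage L F P = ⊤

end Vertex

end PBiset

end

/-! Being a vertex means that `F(b_L^Q)` is onto `F(Q)`, so it is non-zero because `F(Q) ≠ 0`. Now
`b_L^Q` is a finite sum of scalar multiples of elements that factor through groups `T/S` with
`(T/S)^@ ≅ L`. An element factoring through a group where `F` vanishes acts as zero
(`map_prod_eq_zero`), so `F(T/S) ≠ 0` for at least one of these sections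
(`exists_section_of_map_bIdempotent_ne_zero`). Since `F` vanishes on all proper subquotients of `Q`,
this `T/S` is isomorphic to `Q`, whence `L ≅ (T/S)^@ ≅ Q^@`.

Only this factorization of `b_L^Q` matters: neither the idempotent relations nor the values of the
coefficients play a role.

The last isomorphism is the group-theoretic half of the proof. `P^@` is defined through a choice of
kernel, so its invariance under isomorphism (`nonempty_atoricQuotient_mulEquiv`) requires
independence of that choice (`nonempty_quotient_mulEquiv_of_maximal`). For the latter, all the
maximal `N` have the same product with `Φ(G)`, so a complement of one of them that contains `Φ(G)`
is a complement of every other, and all the quotients are isomorphic to it. -/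

namespace PBiset

/-! ### Finite `p`-groups: Frattini subgroup, complements, and invariance of `P^@`. -/

section PGroups

variable {p : ℕ} [Fact p.Prime] {G : Type u} [Group G]

theorem zpowers_normal_of_forall_commute {x : G} (hc : ∀ y, x * y = y * x) :
    (Subgroup.zpowers x).Normal := by
  refine ⟨?_⟩
  rintro _ ⟨k, rfl⟩ g
  refine ⟨k, ?_⟩
  have h : Commute x g := hc g
  change x ^ k = g * x ^ k * g⁻¹
  rw [← (h.zpow_left k).eq, mul_inv_cancel_right]

/-- A central element of order dividing `p` lies in `N Φ(G)` for every maximal normal subgroup `N`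
with `N ∩ Φ(G) = 1`. -/
theorem mem_sup_frattini_of_maximal {N : Subgroup G}
    (hN : Maximal (· ∈ frattiniFree G) N) {x : G} (hc : ∀ y, x * y = y * x) (hx : x ^ p = 1) :
    x ∈ N ⊔ frattini G := by
  by_contra hxN
  have hNn : N.Normal := hN.1.1
  have hZ := zpowers_normal_of_forall_commute hc
  -- Maximality would then put `x` in `N`, a contradiction. Let `n * x ^ k` lie in `Φ(G)`, so that
  -- `x ^ k` lies in `N Φ(G)`. If `p ∤ k`, Bézout and `x ^ p = 1` give back `x` from `x ^ k`,
  -- against `hxN`. So `x ^ k = 1`, and `n` lies in `N ∩ Φ(G) = 1`.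
  have hmem : N ⊔ Subgroup.zpowers x ∈ frattiniFree G := by
    refine ⟨inferInstance, (Subgroup.eq_bot_iff_forall _).2 ?_⟩
    rintro z ⟨hz, hzΦ⟩
    obtain ⟨n, hn, _, ⟨k, rfl⟩, rfl⟩ := Subgroup.mem_sup_of_normal_right.1 hz
    change n * x ^ k ∈ frattini G at hzΦ
    change n * x ^ k = 1
    have hxk : x ^ k = 1 := by
      by_cases hk : (p : ℤ) ∣ k
      · obtain ⟨j, rfl⟩ := hk
        rw [zpow_mul, zpow_natCast, hx, one_zpow]
      · exfalso
        have hxkN : x ^ k ∈ N ⊔ frattini G := by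
          have := Subgroup.mul_mem_sup (N.inv_mem hn) hzΦ
          rwa [inv_mul_cancel_left] at this
        obtain ⟨a, b, hab⟩ :=
          ((Nat.prime_iff_prime_int.1 Fact.out).coprime_iff_not_dvd.2 hk : IsCoprime (p : ℤ) k)
        have h1 : x ^ (a * p + b * k) ∈ N ⊔ frattini G := by
          rw [zpow_add, mul_comm a, zpow_mul x _ a, zpow_natCast, hx, one_zpow, one_mul,
            mul_comm, zpow_mul]
          exact Subgroup.zpow_mem _ hxkN b
        rw [hab, zpow_one] at h1
        exact hxN h1
    rw [hxk, mul_one] at hzΦ ⊢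
    have : n ∈ N ⊓ frattini G := ⟨hn, hzΦ⟩
    rwa [hN.1.2, Subgroup.mem_bot] at this
  exact hxN (Subgroup.mem_sup_left
    (hN.2 hmem le_sup_left (Subgroup.mem_sup_right (Subgroup.mem_zpowers x))))

variable [Finite G]

open scoped commutatorElement

/-- In a nilpotent group every maximal subgroup `M` is normal; `G/M` is then simple and solvable,
hence abelian, so `M` contains all commutators. -/
theorem commutatorElement_mem_frattini (hG : IsPGroup p G) (x y : G) : ⁅x, y⁆ ∈ frattini G := by
  have hnil : Group.IsNilpotent G := hG.isNilpotent
  simp only [frattini, Order.radical, Subgroup.mem_iInf]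
  intro M hM
  have hn : M.Normal :=
    Subgroup.NormalizerCondition.normal_of_coatom M Group.normalizerCondition_of_isNilpotent hM
  have hnt : Nontrivial (G ⧸ M) := QuotientGroup.nontrivial_iff.2 hM.1
  have hs : IsSimpleGroup (G ⧸ M) := by
    refine ⟨fun H _ => ?_⟩
    have hle : M ≤ H.comap (QuotientGroup.mk' M) := by
      intro m hm
      have h : QuotientGroup.mk' M m = 1 := (QuotientGroup.eq_one_iff m).2 hm
      rw [Subgroup.mem_comap, h]
      exact H.one_mem
    rcases hM.le_iff.1 hle with h | h
    · right
      apply Subgroup.comap_injective (QuotientGroup.mk'_surjective M)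
      rw [h, Subgroup.comap_top]
    · left
      apply Subgroup.comap_injective (QuotientGroup.mk'_surjective M)
      rw [h]
      exact (QuotientGroup.ker_mk' M).symm
  have hc := IsSimpleGroup.comm_iff_isSolvable (G := G ⧸ M) |>.2 inferInstance
  rw [← QuotientGroup.eq_one_iff]
  change (⁅(x : G ⧸ M), (y : G ⧸ M)⁆ : G ⧸ M) = 1
  exact commutatorElement_eq_one_iff_mul_comm.2 (hc _ _)

/-- If a maximal subgroup `M`, which is normal, misses `x ^ p`, then `G = ⟨x ^ p⟩ M`, so `x ^ (1 - p
k)` lies in `M` for some `k`. As `1 - p k` is prime to the order of `x`, a power of `p`, `x` itself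
lies in `M`, a contradiction. -/
theorem pow_prime_mem_frattini (hG : IsPGroup p G) (x : G) : x ^ p ∈ frattini G := by
  have hnil : Group.IsNilpotent G := hG.isNilpotent
  simp only [frattini, Order.radical, Subgroup.mem_iInf]
  intro M hM
  have hn : M.Normal :=
    Subgroup.NormalizerCondition.normal_of_coatom M Group.normalizerCondition_of_isNilpotent hM
  by_contra hx
  have htop : Subgroup.zpowers (x ^ p) ⊔ M = ⊤ := by
    refine hM.2 _ (lt_of_le_of_ne le_sup_right fun h => hx ?_)
    rw [h]
    exact Subgroup.mem_sup_left (Subgroup.mem_zpowers _)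
  obtain ⟨y, ⟨k, rfl⟩, m, hm, hxm⟩ :=
    Subgroup.mem_sup_of_normal_right.1 (htop ▸ Subgroup.mem_top x)
  obtain ⟨n, hxn⟩ := hG x
  have hmx : x ^ (1 - (p : ℤ) * k) ∈ M := by
    have : m = x ^ (-((p : ℤ) * k) + 1) := by
      rw [zpow_add, zpow_neg, zpow_one, zpow_mul, zpow_natCast, eq_inv_mul_iff_mul_eq]
      exact hxm
    rwa [this, neg_add_eq_sub] at hm
  have hcop : IsCoprime (1 - (p : ℤ) * k) ((p : ℤ) ^ n) :=
    IsCoprime.pow_right ⟨1, k, by ring⟩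
  obtain ⟨a, b, hab⟩ := hcop
  have hxM : x ∈ M := by
    have h1 : x ^ (a * (1 - (p : ℤ) * k) + b * (p : ℤ) ^ n) ∈ M := by
      have h2 : x ^ ((p : ℤ) ^ n) = 1 := by exact_mod_cast hxn
      rw [zpow_add, mul_comm b, zpow_mul x _ b, h2, one_zpow, mul_one, mul_comm, zpow_mul]
      exact M.zpow_mem hmx a
    rwa [hab, zpow_one] at h1
  exact hx (M.pow_mem hxM p)

/-- `⁅x, y⁆` lies in `N` by normality and in `Φ(G)`, hence is trivial. With the next lemma, this
makes `N` central of exponent dividing `p`, as `mem_sup_frattini_of_maximal` requires. -/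
theorem commute_of_mem_frattiniFree (hG : IsPGroup p G) {N : Subgroup G} (hN : N ∈ frattiniFree G)
    {x : G} (hx : x ∈ N) (y : G) : x * y = y * x := by
  have h : ⁅x, y⁆ ∈ N ⊓ frattini G := by
    refine ⟨?_, commutatorElement_mem_frattini hG x y⟩
    have h := N.mul_mem hx (hN.1.conj_mem _ (N.inv_mem hx) y)
    rwa [commutatorElement_def, mul_assoc, mul_assoc, ← mul_assoc y]
  rw [hN.2, Subgroup.mem_bot] at h
  exact commutatorElement_eq_one_iff_mul_comm.1 h

theorem pow_eq_one_of_mem_frattiniFree (hG : IsPGroup p G) {N : Subgroup G}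
    (hN : N ∈ frattiniFree G) {x : G} (hx : x ∈ N) : x ^ p = 1 := by
  have h : x ^ p ∈ N ⊓ frattini G := ⟨N.pow_mem hx p, pow_prime_mem_frattini hG x⟩
  rwa [hN.2, Subgroup.mem_bot] at h

/-- A normal subgroup `N` with `N ∩ Φ(G) = 1` has a complement containing `Φ(G)`. -/
theorem exists_complement_of_mem_frattiniFree (hG : IsPGroup p G) {N : Subgroup G}
    (hN : N ∈ frattiniFree G) : ∃ K : Subgroup G, frattini G ≤ K ∧ K ⊓ N = ⊥ ∧ K ⊔ N = ⊤ := by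
  -- A supplement of `N` that is minimal among those containing `Φ(G)` is a complement: any `x` in
  -- `K ∩ N` will be shown to lie in every maximal subgroup, hence in `N ∩ Φ(G) = 1`.
  obtain ⟨K, hK⟩ := (Set.toFinite {K : Subgroup G | frattini G ≤ K ∧ K ⊔ N = ⊤}).exists_minimal
    ⟨⊤, le_top, top_sup_eq _⟩
  refine ⟨K, hK.1.1, (Subgroup.eq_bot_iff_forall _).2 ?_, hK.1.2⟩
  rintro x ⟨hxK, hxN⟩
  have hNn : N.Normal := hN.1
  have hc := commute_of_mem_frattiniFree hG hN hxN
  suffices hx : x ∈ frattini G by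
    have : x ∈ N ⊓ frattini G := ⟨hxN, hx⟩
    rwa [hN.2, Subgroup.mem_bot] at this
  simp only [frattini, Order.radical, Subgroup.mem_iInf]
  intro M hM
  by_contra hxM
  have hZ := zpowers_normal_of_forall_commute hc
  have htop : M ⊔ Subgroup.zpowers x = ⊤ :=
    hM.2 _ (lt_of_le_of_ne le_sup_left fun h => hxM
      (h ▸ Subgroup.mem_sup_right (Subgroup.mem_zpowers x)))
  -- If `M` misses `x`, then `G = M ⟨x⟩` with `⟨x⟩ ≤ K ∩ N`. Hence `K ∩ M` still supplements `N` and
  -- contains `Φ(G)`, so minimality gives `K ≤ M`, although `x` lies in `K`.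
  have hKM : K ≤ (K ⊓ M) ⊔ N := by
    intro q hq
    obtain ⟨m, hm, z, hz, rfl⟩ :=
      Subgroup.mem_sup_of_normal_right.1 (htop ▸ Subgroup.mem_top q)
    have hzK : z ∈ K := (Subgroup.zpowers_le.2 hxK) hz
    have hzN : z ∈ N := (Subgroup.zpowers_le.2 hxN) hz
    exact Subgroup.mul_mem_sup ⟨(K.mul_mem_cancel_right hzK).1 hq, hm⟩ hzN
  have hle : K ≤ K ⊓ M := hK.2
    ⟨le_inf hK.1.1 (frattini_le_coatom hM), top_le_iff.1 (hK.1.2 ▸ sup_le hKM le_sup_right)⟩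
    inf_le_left
  exact hxM (hle hxK).2

/-- Up to isomorphism, `G / N` does not depend on the maximal normal subgroup `N` with
`N ∩ Φ(G) = 1`. -/
theorem nonempty_quotient_mulEquiv_of_maximal (hG : IsPGroup p G) {N N' : Subgroup G} [N.Normal]
    [N'.Normal] (hN : Maximal (· ∈ frattiniFree G) N) (hN' : Maximal (· ∈ frattiniFree G) N') :
    Nonempty (G ⧸ N ≃* G ⧸ N') := by
  obtain ⟨K, hΦ, hinf, hsup⟩ := exists_complement_of_mem_frattiniFree hG hN.1
  have hle {A B : Subgroup G} (hA : A ∈ frattiniFree G) (hB : Maximal (· ∈ frattiniFree G) B) :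
      A ≤ B ⊔ frattini G := fun x hx =>
    mem_sup_frattini_of_maximal (p := p) hB (commute_of_mem_frattiniFree hG hA hx)
      (pow_eq_one_of_mem_frattiniFree hG hA hx)
  -- An element of `K ∩ N'` is `n * d` with `n` in `N` and `d` in `Φ(G) ≤ K`. Then `n` lies in `K ∩
  -- N = 1`, and what remains lies in `N' ∩ Φ(G) = 1`.
  have hinf' : K ⊓ N' = ⊥ := by
    refine (Subgroup.eq_bot_iff_forall _).2 ?_
    rintro x ⟨hxK, hxN'⟩
    obtain ⟨n, hn, d, hd, rfl⟩ := Subgroup.mem_sup_of_normal_right.1 (hle hN'.1 hN hxN')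
    have hn1 : n ∈ K ⊓ N := ⟨(K.mul_mem_cancel_right (hΦ hd)).1 hxK, hn⟩
    rw [hinf, Subgroup.mem_bot] at hn1
    subst hn1
    rw [one_mul] at hxN' ⊢
    have : d ∈ N' ⊓ frattini G := ⟨hxN', hd⟩
    rwa [hN'.1.2, Subgroup.mem_bot] at this
  have hsup' : K ⊔ N' = ⊤ := by
    rw [eq_top_iff, ← hsup]
    exact sup_le le_sup_left ((hle hN.1 hN').trans (sup_le le_sup_right (hΦ.trans le_sup_left)))
  have hcompl {A : Subgroup G} [A.Normal] (h1 : K ⊓ A = ⊥) (h2 : K ⊔ A = ⊤) : K.IsComplement' A :=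
    Subgroup.isComplement'_of_disjoint_and_mul_eq_univ (disjoint_iff.2 h1)
      (by rw [← Subgroup.mul_normal, h2, Subgroup.coe_top])
  -- Both quotients are identified with the common complement `K`.
  exact ⟨(hcompl hinf hsup).QuotientMulEquiv.trans (hcompl hinf' hsup').QuotientMulEquiv.symm⟩

theorem map_mem_frattiniFree {G H : Type u} [Group G] [Group H] (e : G ≃* H) {N : Subgroup G}
    (hN : N ∈ frattiniFree G) : N.map e.toMonoidHom ∈ frattiniFree H := by
  refine ⟨hN.1.map _ e.surjective, (Subgroup.eq_bot_iff_forall _).2 ?_⟩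
  rintro _ ⟨⟨x, hx, rfl⟩, hΦ⟩
  have h := frattini_le_comap_frattini_of_surjective (φ := e.symm.toMonoidHom) e.symm.surjective hΦ
  have hx' : x ∈ N ⊓ frattini G := ⟨hx, by simpa using h⟩
  rw [hN.2, Subgroup.mem_bot] at hx'
  rw [hx', map_one]

/-- The isomorphism carries the chosen kernel of `G` to a maximal element for `H`, but not
necessarily to the chosen one; independence of the choice closes the gap. -/
theorem nonempty_atoricQuotient_mulEquiv {H : Type u} [Group H] [Finite H] (hG : IsPGroup p G)
    (e : G ≃* H) : Nonempty (AtoricQuotient G ≃* AtoricQuotient H) := by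
  have hG' := atoricKernel_maximal G
  have hmax : Maximal (· ∈ frattiniFree H) ((atoricKernel G).map e.toMonoidHom) := by
    refine ⟨map_mem_frattiniFree e hG'.1, fun M hM hle => ?_⟩
    have h := hG'.2 (map_mem_frattiniFree e.symm hM) (fun x hx =>
      ⟨e x, hle ⟨x, hx, rfl⟩, e.symm_apply_apply x⟩)
    intro y hy
    exact ⟨e.symm y, h ⟨y, hy, rfl⟩, e.apply_symm_apply y⟩
  have : ((atoricKernel G).map e.toMonoidHom).Normal := hmax.1.1
  obtain ⟨f⟩ := nonempty_quotient_mulEquiv_of_maximal (hG.of_equiv e) hmax (atoricKernel_maximal H)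
  exact ⟨(QuotientGroup.congr _ ((atoricKernel G).map e.toMonoidHom) e rfl).trans f⟩

end PGroups

/-! ### Action of `b_L^P` on a functor. -/

section Functors

variable {R : Type v} [CommRing R] {p : ℕ} (F : PBisetCat.{u, v} R p ⥤ ModuleCat.{w} R)

/-- An element of `RB(P, P)` which factors through a group at which `F` vanishes acts as zero
on `F(P)`. -/
theorem map_prod_eq_zero [F.Additive] (P X : PBisetCat.{u, v} R p) [Subsingleton (F.obj X)]
    (a : RB R P.obj.carrier X.obj.carrier) (b : RB R X.obj.carrier P.obj.carrier) :
    F.map (ObjectProperty.homMk (RB.prod a b : P.obj ⟶ P.obj) : P ⟶ P) = 0 := by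
  let f : P ⟶ X := ObjectProperty.homMk (b : P.obj ⟶ X.obj)
  let g : X ⟶ P := ObjectProperty.homMk (a : X.obj ⟶ P.obj)
  change F.map (f ≫ g) = 0
  rw [F.map_comp]
  ext x
  change (F.map g).hom ((F.map f).hom x) = 0
  rw [Subsingleton.elim ((F.map f).hom x) 0, map_zero]

/-- If `b_L^P` acts non-trivially on `F(P)`, then `F` does not vanish at some section `T/S` of `P`
with `(T/S)^@ ≅ L`. -/
theorem exists_section_of_map_bIdempotent_ne_zero [F.Additive] [F.Linear R] (L : Type u) [Group L]
    (P : PBisetCat.{u, v} R p)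
    (h : F.map (ObjectProperty.homMk (bIdempotent R L P.obj.carrier : P.obj ⟶ P.obj) : P ⟶ P) ≠ 0) :
    ∃ s : GroupSection P.obj.carrier, Nonempty (AtoricQuotient s.Quot ≃* L) ∧
      Nontrivial (F.obj (PBisetCat.of R s.Quot ((P.property.to_subgroup s.T).to_quotient _))) := by
  by_contra! hcon
  -- The elements acting as zero on `F(P)` form a submodule, so it suffices to treat each summand of
  -- `b_L^P` without its scalar. `h0` also covers the value `0` that a `finsum` takes on an empty
  -- condition.
  let C (x : RB R P.obj.carrier P.obj.carrier) : Prop :=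
    F.map (ObjectProperty.homMk (x : P.obj ⟶ P.obj) : P ⟶ P) = 0
  have h0 : C 0 := F.map_zero P P
  have hadd (x y) (hx : C x) (hy : C y) : C (x + y) := by
    have := F.map_add (f := (ObjectProperty.homMk (x : P.obj ⟶ P.obj) : P ⟶ P))
      (g := ObjectProperty.homMk (y : P.obj ⟶ P.obj))
    exact this.trans (by rw [show F.map _ = 0 from hx, show F.map _ = 0 from hy, add_zero])
  have hsmul (r : R) (x) (hx : C x) : C (r • x) := by
    have := F.map_smul (f := (ObjectProperty.homMk (x : P.obj ⟶ P.obj) : P ⟶ P)) r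
    exact this.trans (by rw [show F.map _ = 0 from hx, smul_zero])
  refine h (?_ : C (bIdempotent R L P.obj.carrier))
  refine finsum_induction C h0 hadd fun c => finsum_induction C h0 hadd fun hc => hsmul _ _ ?_
  have := hcon c.out.1 hc
  -- The factorization through `T/S` has `Indinf · φ_1` as left factor and `Defres` as right factor.
  exact map_prod_eq_zero F P
    (PBisetCat.of R c.out.1.Quot ((P.property.to_subgroup c.out.1.T).to_quotient _)) _ _

end Functors

end PBiset

/-! ### The vertex of `F` read off from a minimal group. -/

theorem mainTheorem10 (p : ℕ) [Fact p.Prime] (R : Type v) [CommRing R] (hp : IsUnit (p : R))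
    (F : PBiset.PBisetCat.{u, v} R p ⥤ ModuleCat.{w} R) [F.Additive] [F.Linear R]
    (hF : Indecomposable F)
    (L : Type u) [Group L] (hL : PBiset.IsVertex L F)
    (Q : Type u) [Group Q] [Finite Q] (hQ : IsPGroup p Q)
    (hFQ : Nontrivial (F.obj (PBiset.PBisetCat.of R Q hQ)))
    (hmin : ∀ (H : Type u) [Group H] [Finite H] (hH : IsPGroup p H),
      PBiset.IsProperSubquotient H Q → Subsingleton (F.obj (PBiset.PBisetCat.of R H hH))) :
    Nonempty (L ≃* PBiset.AtoricQuotient Q) := by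
  have hne : F.map (ObjectProperty.homMk (PBiset.bIdempotent R L Q :
      (PBiset.PBisetCat.of R Q hQ).obj ⟶ (PBiset.PBisetCat.of R Q hQ).obj) :
      PBiset.PBisetCat.of R Q hQ ⟶ PBiset.PBisetCat.of R Q hQ) ≠ 0 := by
    intro h0
    have h := hL.2 (PBiset.PBisetCat.of R Q hQ)
    -- A zero map has image `⊥`, while the vertex condition makes the image `⊤`; these differ
    -- because `F(Q)` is non-zero.
    refine bot_ne_top (h ▸ ?_ : (⊥ : Submodule R (F.obj (PBiset.PBisetCat.of R Q hQ))) = ⊤)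
    refine (LinearMap.range_eq_bot.2 ?_).symm
    exact congrArg ModuleCat.Hom.hom h0
  obtain ⟨s, ⟨e⟩, hs⟩ : ∃ s : PBiset.GroupSection Q,
      Nonempty (PBiset.AtoricQuotient s.Quot ≃* L) ∧ Nontrivial (F.obj (PBiset.PBisetCat.of R s.Quot
        ((hQ.to_subgroup s.T).to_quotient _))) := PBiset.exists_section_of_map_bIdempotent_ne_zero F L
    (PBiset.PBisetCat.of R Q hQ) hne
  have hpg : IsPGroup p s.Quot := (hQ.to_subgroup s.T).to_quotient _
  -- Either `T/S ≅ Q`, and `P^@` is invariant under isomorphism, or `T/S` is a proper subquotient at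
  -- which `F` must vanish, contrary to the choice of the section.
  by_cases hiso : Nonempty (s.Quot ≃* Q)
  · obtain ⟨f⟩ := hiso
    obtain ⟨g⟩ := PBiset.nonempty_atoricQuotient_mulEquiv hpg f
    exact ⟨e.symm.trans g⟩
  · exact absurd (hmin s.Quot hpg ⟨⟨s, ⟨MulEquiv.refl _⟩⟩, hiso⟩)
      (not_subsingleton_iff_nontrivial.2 hs)
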